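/- Let $v_1,\dots,v_n$ be real variables, each restricted to a nonempty compact interval $\mathrm{range}(v_i)\subset\mathbb R$; literals are the elements of $\{\pm v_1,\dots,\pm v_n\}$, and $\mathrm{range}(-v_i)=-\mathrm{range}(v_i)$. A continuous formula $\Gamma$ is a finite set of constraints $x\le f(y)$ with $x,y$ literals and $f:\mathbb R\to\mathbb R$ a continuous strictly increasing bijection; it is satisfiable if some choice of values $v_i\in\mathrm{range}(v_i)$ satisfies all constraints. It is symmetric if, with each constraint $x\le f(y)$, it also contains the equivalent constraint $-y\le\widetilde f(-x)$, where $\widetilde f(c)=-f^{-1}(-c)$. Let $H(\Gamma)$ be obtained from $\Gamma$ by first adding $x\le f(g(z))$ for every pair of constraints $x\le f(y)$, $y\le g(z)$ of $\Gamma$ with $y\ne x$ and $y\neq z$, and then, for each pair of literals $x,y$ with at least one constraint from $x$ to $y$, replacing all constraints $x\le f_i(y)$ by the single constraint $x\le(\min_i f_i)(y)$. For a continuous strictly increasing bijection $f$ of $\mathbb R$ and $x\in\mathbb R$ put $$f^\infty(x)=\inf\bigl\{y\in\mathbb R : y\ge \sup\{z\in\mathbb R: z\le x,\ z\le f(z)\},\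 y>f(y)\bigr\}\in\mathbb R\cup\{\pm\infty\},$$ with $\inf\emptyset=+\infty$ and $\sup\emptyset=-\infty$. Let $V(\Gamma)$ be obtained from $H^{\lceil\log_2 n+1\rceil}(\Gamma)$ by replacing each loop $x\le f(x)$ by $x\le f^\infty(x)$; all functions are extended to $\mathbb R\cup\{\pm\infty\}$ by fixing $\pm\infty$. A path from $x$ to $y$ in $V(\Gamma)$ is a nonempty list of constraints $x=x_1\le f_1(x_2),\dots,x_k\le f_k(x_{k+1})$ of $V(\Gamma)$ with $x_{k+1}=y$; it is tight if loops and constraints that are not loops alternate along it. Let $\min_{x\to y}(c)$ be the infimum of $(f_1\circ\dots\circ f_k)(c)$ over all tight paths from $x$ to $y$ in $V(\Gamma)$ ($+\infty$ if there are none). Then a symmetric continuous formula $\Gamma$ is satisfiable if and only if neither of the following happens: 1. There are literals $x$ and $y$ with $\min_{x\to y}(\max\mathrm{range}(y))<\min\mathrm{range}(x)$. 2. There are a literal $x$ and a $c\in\mathrm{range}(x)$ with $\min_{x\to -x}(-c)<c$ and $\min_{-x\to x}(c)<-c$. -/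

import Mathlib

namespace ContinuousTwoSAT

/-- The literals `v_i` (`pos i`) and `-v_i` (`neg i`) over the variables `v_1, …, v_n`. -/
inductive Literal (n : ℕ) : Type
  | pos (i : Fin n) : Literal n
  | neg (i : Fin n) : Literal n

instance {n : ℕ} : Neg (Literal n) where
  neg x := match x with
    | .pos i => .neg i
    | .neg i => .pos i

/-- The real value of a literal under an assignment of the variables. -/
def Literal.val {n : ℕ} (a : Fin n → ℝ) : Literal n → ℝ
  | .pos i => a i
  | .neg i => -a i

/-- The constraint `lhs ≤ fn rhs`. The order isomorphisms `ℝ ≃o ℝ` are exactly the strictly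
increasing bijections of `ℝ`, and these are automatically continuous. -/
structure Constraint (n : ℕ) where
  lhs : Literal n
  rhs : Literal n
  fn : ℝ ≃o ℝ

/-- `f ↦ f̃`, where `f̃ c = -f⁻¹(-c)`. -/
def dual (f : ℝ ≃o ℝ) : ℝ ≃o ℝ where
  toFun c := -f.symm (-c)
  invFun c := -f (-c)
  left_inv c := by simp
  right_inv c := by simp
  map_rel_iff' := by
    intro a b
    change -f.symm (-a) ≤ -f.symm (-b) ↔ a ≤ b
    rw [neg_le_neg_iff, f.symm.le_iff_le, neg_le_neg_iff]

/-- The pointwise minimum of a nonempty finite set of increasing bijections of `ℝ`, which is again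
an increasing bijection. -/
noncomputable def minIso (S : Finset (ℝ ≃o ℝ)) (hS : S.Nonempty) : ℝ ≃o ℝ where
  toFun c := S.inf' hS (fun f => f c)
  invFun c := S.sup' hS (fun f => f.symm c)
  left_inv c := by
    apply le_antisymm
    · refine Finset.sup'_le _ _ fun f hf => ?_
      rw [← f.le_iff_le, f.apply_symm_apply]
      exact Finset.inf'_le (fun f : ℝ ≃o ℝ => f c) hf
    · obtain ⟨f, hf, h⟩ := Finset.exists_mem_eq_inf' hS (fun f : ℝ ≃o ℝ => f c)
      calc c = f.symm (S.inf' hS (fun f => f c)) := by rw [h, f.symm_apply_apply]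
        _ ≤ _ := Finset.le_sup' (fun g : ℝ ≃o ℝ => g.symm (S.inf' hS (fun f => f c))) hf
  right_inv c := by
    apply le_antisymm
    · obtain ⟨f, hf, h⟩ := Finset.exists_mem_eq_sup' hS (fun f : ℝ ≃o ℝ => f.symm c)
      calc _ ≤ f (S.sup' hS (fun f => f.symm c)) :=
            Finset.inf'_le (fun g : ℝ ≃o ℝ => g (S.sup' hS (fun f => f.symm c))) hf
        _ = c := by rw [h, f.apply_symm_apply]
    · refine Finset.le_inf' _ _ fun f hf => ?_
      rw [← f.symm.le_iff_le, f.symm_apply_apply]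
      exact Finset.le_sup' (fun f : ℝ ≃o ℝ => f.symm c) hf
  map_rel_iff' := by
    intro a b
    have hmono : StrictMono fun c : ℝ => S.inf' hS (fun f : ℝ ≃o ℝ => f c) := by
      intro a b hab
      refine (Finset.lt_inf'_iff hS).2 fun f hf => ?_
      exact (Finset.inf'_le (fun f : ℝ ≃o ℝ => f a) hf).trans_lt (f.strictMono hab)
    exact hmono.le_iff_le

/-- A continuous formula in `n` real variables: a (nonempty) compact interval `[lo i, hi i]` for each
variable `v_i`, and finitely many constraints. -/
structure ContinuousFormula (n : ℕ) where
  lo : Fin n → ℝ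
  hi : Fin n → ℝ
  lo_le_hi : ∀ i, lo i ≤ hi i
  constraints : Finset (Constraint n)

/-- A constraint between extended-real-valued literals, used for formulas with infinite
compositions. -/
structure ExtConstraint (n : ℕ) where
  lhs : Literal n
  rhs : Literal n
  fn : EReal → EReal

/-- `f^∞ x = inf {y ≥ sup {z ≤ x : z ≤ f z} : y > f y}`, where `y` and `z` range over `ℝ`, and the
supremum and infimum are taken in `ℝ ∪ {±∞}` (so `sup ∅ = -∞` and `inf ∅ = +∞`). -/
noncomputable def infComp (f : ℝ → ℝ) (x : ℝ) : EReal :=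
  sInf ((fun y : ℝ => (y : EReal)) ''
    {y : ℝ | sSup ((fun z : ℝ => (z : EReal)) '' {z : ℝ | z ≤ x ∧ z ≤ f z}) ≤ (y : EReal) ∧ f y < y})

/-- The extension of `g : ℝ → ℝ ∪ {±∞}` to `ℝ ∪ {±∞}` that fixes `-∞` and `+∞`. -/
noncomputable def extend (g : ℝ → EReal) (x : EReal) : EReal :=
  EReal.rec (motive := fun _ => EReal) ⊥ g ⊤ x

namespace ExtConstraint

/-- `[e₁, …, e_k]` is a path from `x` to `y` with constraints in `V`: a nonempty list of constraints
`x = x₁ ≤ f₁(x₂), …, x_k ≤ f_k(x_{k+1} = y)`. -/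
inductive IsPath {n : ℕ} (V : Set (ExtConstraint n)) :
    Literal n → Literal n → List (ExtConstraint n) → Prop
  | single (e : ExtConstraint n) (he : e ∈ V) : IsPath V e.lhs e.rhs [e]
  | cons (e : ExtConstraint n) (he : e ∈ V) (y : Literal n) (p : List (ExtConstraint n))
      (hp : IsPath V e.rhs y p) : IsPath V e.lhs y (e :: p)

/-- A path is tight if it alternates between loops and constraints that are not loops. -/
def IsTight {n : ℕ} (p : List (ExtConstraint n)) : Prop :=
  List.IsChain (fun e e' => e.lhs = e.rhs ↔ ¬ e'.lhs = e'.rhs) p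

/-- `(f₁ ∘ ⋯ ∘ f_k) c` for a path `[e₁, …, e_k]` with functions `f₁, …, f_k`. -/
def eval {n : ℕ} (p : List (ExtConstraint n)) (c : EReal) : EReal :=
  p.foldr (fun e d => e.fn d) c

end ExtConstraint

namespace ContinuousFormula

variable {n : ℕ} (Γ : ContinuousFormula n)

/-- `min (range x)`, where `range (-v_i) = -range (v_i)`. -/
def rangeMin : Literal n → ℝ
  | .pos i => Γ.lo i
  | .neg i => -Γ.hi i

/-- `max (range x)`. -/
def rangeMax : Literal n → ℝ
  | .pos i => Γ.hi i
  | .neg i => -Γ.lo i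

/-- The range of a literal. -/
def range (x : Literal n) : Set ℝ := Set.Icc (Γ.rangeMin x) (Γ.rangeMax x)

/-- Some assignment of values `v_i ∈ range v_i` satisfies every constraint. -/
def Satisfiable : Prop :=
  ∃ a : Fin n → ℝ, (∀ i, a i ∈ Set.Icc (Γ.lo i) (Γ.hi i)) ∧
    ∀ C ∈ Γ.constraints, C.lhs.val a ≤ C.fn (C.rhs.val a)

/-- With every constraint `x ≤ f(y)` the formula contains the equivalent one `-y ≤ f̃(-x)`. -/
def IsSymmetric : Prop :=
  ∀ C ∈ Γ.constraints, (⟨-C.rhs, -C.lhs, dual C.fn⟩ : Constraint n) ∈ Γ.constraints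

open Classical in
/-- Add `x ≤ f(g(z))` for all constraints `x ≤ f(y)`, `y ≤ g(z)` with `y ≠ x` and `y ≠ z`. -/
noncomputable def addCompositions (K : Finset (Constraint n)) : Finset (Constraint n) :=
  K ∪ ((K ×ˢ K).filter
      (fun p => p.1.rhs = p.2.lhs ∧ p.1.rhs ≠ p.1.lhs ∧ p.1.rhs ≠ p.2.rhs)).image
    (fun p => ⟨p.1.lhs, p.2.rhs, p.2.fn.trans p.1.fn⟩)

open Classical in
/-- The functions `f` with `x ≤ f(y)` in `K`. -/
noncomputable def functionsBetween (K : Finset (Constraint n)) (x y : Literal n) :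
    Finset (ℝ ≃o ℝ) :=
  (K.filter (fun C => C.lhs = x ∧ C.rhs = y)).image Constraint.fn

theorem functionsBetween_nonempty (K : Finset (Constraint n)) (C : Constraint n) (hC : C ∈ K) :
    (functionsBetween K C.lhs C.rhs).Nonempty := by
  classical
  exact ⟨C.fn, by simpa [functionsBetween] using ⟨C, ⟨hC, rfl, rfl⟩, rfl⟩⟩

/-- The constraint `x ≤ min_i f_i(y)`, where `x` and `y` are the literals of `C ∈ K` and the `f_i` are
all the functions with `x ≤ f_i(y)` in `K`. -/
noncomputable def minOfParallel (K : Finset (Constraint n)) (C : Constraint n) (hC : C ∈ K) :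
    Constraint n where
  lhs := C.lhs
  rhs := C.rhs
  fn := minIso (functionsBetween K C.lhs C.rhs) (functionsBetween_nonempty K C hC)

open Classical in
/-- For all literals `x` and `y`, replace the constraints from `x` to `y` by their minimum. -/
noncomputable def mergeParallel (K : Finset (Constraint n)) : Finset (Constraint n) :=
  K.attach.image (fun C : {C : Constraint n // C ∈ K} => minOfParallel K C.1 C.2)

/-- The formula `H(Γ)`. -/
noncomputable def H : ContinuousFormula n :=
  { Γ with constraints := mergeParallel (addCompositions Γ.constraints) }

open Classical in
/-- The constraints of `V(Γ)`: those of `H^⌈log₂ n + 1⌉(Γ)`, with `x ≤ f(x)` replaced by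
`x ≤ f^∞(x)`, all functions being extended to `ℝ ∪ {±∞}` by fixing `±∞`. -/
noncomputable def V : Set (ExtConstraint n) :=
  (fun C : Constraint n =>
      (⟨C.lhs, C.rhs,
        if C.lhs = C.rhs then extend (infComp C.fn) else extend (fun c => (C.fn c : EReal))⟩ :
        ExtConstraint n)) ''
    {C | C ∈ (H^[⌈Real.logb 2 (n : ℝ) + 1⌉₊] Γ).constraints}

/-- `min_{x → y}(c)`: the infimum of `p(c)` over the tight paths `p` from `x` to `y` in `V(Γ)`
(`+∞` if there is none). -/
noncomputable def minTight (x y : Literal n) (c : ℝ) : EReal :=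
  sInf {v : EReal | ∃ p : List (ExtConstraint n),
    ExtConstraint.IsPath Γ.V x y p ∧ ExtConstraint.IsTight p ∧ v = ExtConstraint.eval p (c : EReal)}

end ContinuousFormula

end ContinuousTwoSAT

namespace ContinuousTwoSAT

open ExtConstraint ContinuousFormula

variable {n : ℕ}

namespace Literal

/-! Soundness (`val_le_minTight`): a solution satisfies every composed constraint, and `x ≤ f x`
implies `x ≤ f^∞ x`, so each path of `V` gives a valid bound, which rules out both obstructions.

For the converse, tight paths must bound all walks of `Γ` from below (`exists_tight_le`). Simple
paths and cycles have at most `2n` edges, so `rounds n` doublings shortcut each of them by one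
constraint. In a longer walk, a cycle that does not lower the current value is deleted, and one that
does is replaced by the infinite composition of its shortcut. After that the same loop cannot lower
the value again, so two loops never meet.

Hence without obstructions the walks are consistent with the ranges and never exclude a value `c` of
`x` from both sides at once. By symmetry the walks are closed under composition and duality. Under
these conditions `exists_fix` shrinks the range of one variable to a point while keeping all walks
consistent; doing this for each variable gives a solution. -/

noncomputable instance : DecidableEq (Literal n) := Classical.decEq _

theorem neg_pos (i : Fin n) : -(pos i) = neg i := rfl

theorem neg_involutive (x : Literal n) : - -x = x := by cases x <;> rfl

theorem neg_ne_self (x : Literal n) : -x ≠ x := by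
  cases x <;> intro h <;> cases h

theorem val_neg (a : Fin n → ℝ) (x : Literal n) : (-x).val a = -x.val a := by
  cases x
  · rfl
  · exact (neg_neg _).symm

/-- The literals are two copies of the variables. -/
def equivSum : Literal n ≃ Fin n ⊕ Fin n where
  toFun
    | pos i => .inl i
    | neg i => .inr i
  invFun
    | .inl i => pos i
    | .inr i => neg i
  left_inv x := by cases x <;> rfl
  right_inv x := by cases x <;> rfl

instance : Fintype (Literal n) := Fintype.ofEquiv _ equivSum.symm

theorem card_eq : Fintype.card (Literal n) = 2 * n := by
  rw [Fintype.card_congr equivSum, Fintype.card_sum, Fintype.card_fin, two_mul]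

end Literal

/-! ### Extensions to the extended reals -/

/-- The extension of an increasing bijection of `ℝ` to the extended reals. -/
noncomputable def extendIso (f : ℝ ≃o ℝ) : EReal → EReal := extend fun c => (f c : EReal)

theorem extend_top (g : ℝ → EReal) : extend g ⊤ = ⊤ := rfl

theorem extend_coe (g : ℝ → EReal) (c : ℝ) : extend g c = g c := rfl

theorem monotone_extend {g : ℝ → EReal} (hg : Monotone g) : Monotone (extend g) := by
  intro a b hab
  induction a with
  | bot => exact bot_le
  | top => rw [top_le_iff.1 hab]
  | coe a =>
    induction b with
    | bot => exact absurd hab (by simp)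
    | top => exact le_top
    | coe b => exact hg (EReal.coe_le_coe_iff.1 hab)

theorem extendIso_coe (f : ℝ ≃o ℝ) (c : ℝ) : extendIso f c = (f c : EReal) := rfl

theorem monotone_extendIso (f : ℝ ≃o ℝ) : Monotone (extendIso f) :=
  monotone_extend fun _ _ h => EReal.coe_le_coe_iff.2 (f.monotone h)

theorem extendIso_le {f g : ℝ ≃o ℝ} (h : ∀ c, f c ≤ g c) (d : EReal) :
    extendIso f d ≤ extendIso g d := by
  induction d with
  | bot => exact le_rfl
  | top => exact le_rfl
  | coe d => exact EReal.coe_le_coe_iff.2 (h d)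

theorem extendIso_refl (d : EReal) : extendIso (OrderIso.refl ℝ) d = d := by
  induction d <;> rfl

theorem extendIso_trans (f g : ℝ ≃o ℝ) (d : EReal) :
    extendIso (g.trans f) d = extendIso f (extendIso g d) := by
  induction d <;> rfl

/-! ### Infinite compositions -/

theorem monotone_infComp (f : ℝ → ℝ) : Monotone (infComp f) := by
  intro a b hab
  refine sInf_le_sInf (Set.image_mono fun y hy => ⟨le_trans ?_ hy.1, hy.2⟩)
  exact sSup_le_sSup (Set.image_mono fun z hz => ⟨hz.1.trans hab, hz.2⟩)

/-- Here `x` itself takes part in the supremum that bounds every admissible `y` from below. -/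
theorem le_infComp {f : ℝ → ℝ} {x : ℝ} (hx : x ≤ f x) : (x : EReal) ≤ infComp f x := by
  refine le_sInf ?_
  rintro _ ⟨y, hy, rfl⟩
  refine le_trans (le_sSup ?_) hy.1
  exact ⟨x, ⟨le_rfl, hx⟩, rfl⟩

/-- The value `f x` is an admissible `y`: it satisfies `f (f x) < f x`, and `z ≤ f z ≤ f x` for
every `z ≤ x` with `z ≤ f z`. -/
theorem infComp_le {f : ℝ ≃o ℝ} {x : ℝ} (hx : f x < x) : infComp f x ≤ (f x : EReal) := by
  refine sInf_le ⟨f x, ⟨sSup_le ?_, f.strictMono hx⟩, rfl⟩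
  rintro _ ⟨z, hz, rfl⟩
  exact EReal.coe_le_coe_iff.2 (hz.2.trans (f.monotone hz.1))

theorem extend_infComp_le {f : ℝ ≃o ℝ} {d : EReal} (hd : extendIso f d < d) :
    extend (infComp f) d ≤ extendIso f d := by
  induction d with
  | bot => exact absurd hd (by simp)
  | top => exact absurd hd (by simp [extendIso, extend_top])
  | coe d => exact infComp_le (EReal.coe_lt_coe_iff.1 hd)

/-- After an infinite composition the same loop gives no further decrease. Otherwise the infimum is
a real `s` with `f s < s`, and any `y` strictly between them is still admissible, contradicting
minimality. -/
theorem infComp_le_extendIso_infComp (f : ℝ ≃o ℝ) (x : ℝ) :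
    infComp f x ≤ extendIso f (infComp f x) := by
  by_contra! hlt
  obtain ⟨s, hs⟩ : ∃ s : ℝ, infComp f x = s := by
    induction h : infComp f x with
    | bot => rw [h] at hlt; exact absurd hlt (by simp)
    | top => rw [h] at hlt; exact absurd hlt (by simp [extendIso, extend_top])
    | coe s => exact ⟨s, rfl⟩
  rw [hs, extendIso_coe, EReal.coe_lt_coe_iff] at hlt
  obtain ⟨y, hy, hys⟩ := exists_between hlt
  have hyf : f y < y := (f.strictMono hys).trans hy
  have hsup : sSup ((fun z : ℝ => (z : EReal)) '' {z : ℝ | z ≤ x ∧ z ≤ f z}) ≤ (y : EReal) := by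
    refine sSup_le ?_
    rintro _ ⟨z, hz, rfl⟩
    have hzs : z ≤ s := by
      rw [← EReal.coe_le_coe_iff, ← hs]
      exact (le_infComp hz.2).trans (monotone_infComp f hz.1)
    exact EReal.coe_le_coe_iff.2 ((hz.2.trans (f.monotone hzs)).trans hy.le)
  have : infComp f x ≤ (y : EReal) := sInf_le ⟨y, ⟨hsup, hyf⟩, rfl⟩
  rw [hs, EReal.coe_le_coe_iff] at this
  exact absurd hys this.not_gt

theorem extend_infComp_le_extendIso (f : ℝ ≃o ℝ) (d : EReal) :
    extend (infComp f) d ≤ extendIso f (extend (infComp f) d) := by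
  induction d with
  | bot => exact bot_le
  | top => exact le_rfl
  | coe d => exact infComp_le_extendIso_infComp f d

/-! ### Walks -/

/-- A possibly empty chain of constraints `x = x₁ ≤ f₁(x₂), …, x_k ≤ f_k(x_{k+1} = y)`. -/
inductive IsWalk (K : Finset (Constraint n)) :
    Literal n → Literal n → List (Constraint n) → Prop
  | nil (x : Literal n) : IsWalk K x x []
  | cons (C : Constraint n) (hC : C ∈ K) (y : Literal n) (w : List (Constraint n))
      (hw : IsWalk K C.rhs y w) : IsWalk K C.lhs y (C :: w)

/-- The composition `f₁ ∘ ⋯ ∘ f_k` of the functions along a walk. -/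
noncomputable def walkFn (w : List (Constraint n)) : ℝ ≃o ℝ :=
  w.foldr (fun C g => g.trans C.fn) (OrderIso.refl ℝ)

theorem walkFn_cons (C : Constraint n) (w : List (Constraint n)) :
    walkFn (C :: w) = (walkFn w).trans C.fn := rfl

theorem walkFn_append (v w : List (Constraint n)) :
    walkFn (v ++ w) = (walkFn w).trans (walkFn v) := by
  induction v with
  | nil => rfl
  | cons C v ih => rw [List.cons_append, walkFn_cons, ih]; rfl

namespace IsWalk

variable {K : Finset (Constraint n)}

theorem append {x y z : Literal n} {v w : List (Constraint n)} (hv : IsWalk K x y v)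
    (hw : IsWalk K y z w) : IsWalk K x z (v ++ w) := by
  induction hv with
  | nil => exact hw
  | cons C hC y v _ ih => exact .cons C hC z _ (ih hw)

theorem eq_of_nil {x y : Literal n} (h : IsWalk K x y []) : x = y := by
  cases h; rfl

theorem lhs_head {x z : Literal n} {C : Constraint n} {w : List (Constraint n)}
    (h : IsWalk K x z (C :: w)) : C.lhs = x := by
  cases h; rfl

theorem exists_split {x z : Literal n} {v w : List (Constraint n)} (h : IsWalk K x z (v ++ w)) :
    ∃ y, IsWalk K x y v ∧ IsWalk K y z w := by
  induction v generalizing x with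
  | nil => exact ⟨x, .nil x, h⟩
  | cons C v ih =>
    cases h with
    | cons _ hC _ _ hw =>
      obtain ⟨y, h₁, h₂⟩ := ih hw
      exact ⟨y, .cons C hC y v h₁, h₂⟩

theorem mem_map_lhs {x z : Literal n} {w : List (Constraint n)} (h : IsWalk K x z w)
    (hw : w ≠ []) : x ∈ w.map Constraint.lhs := by
  cases h with
  | nil => exact absurd rfl hw
  | cons C hC _ w _ => simp

theorem mem_map_rhs {x z : Literal n} {w : List (Constraint n)} (h : IsWalk K x z w)
    (hw : w ≠ []) : z ∈ w.map Constraint.rhs := by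
  induction h with
  | nil => exact absurd rfl hw
  | cons C hC y w h ih =>
    rcases eq_or_ne w [] with rfl | hne
    · simp [h.eq_of_nil]
    · exact List.mem_cons_of_mem _ (ih hne)

theorem cons_map_rhs {x z : Literal n} {w : List (Constraint n)} (h : IsWalk K x z w) :
    x :: w.map Constraint.rhs = w.map Constraint.lhs ++ [z] := by
  induction h with
  | nil => rfl
  | cons C hC y w h ih => simp only [List.map_cons, List.cons_append, ← ih]

/-- A walk without repeated vertices is a simple path. -/
theorem nodup_map_rhs {x z : Literal n} {w : List (Constraint n)} (h : IsWalk K x z w)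
    (hn : (w.map Constraint.lhs).Nodup) (hz : z ∉ w.map Constraint.lhs) :
    (w.map Constraint.rhs).Nodup := by
  have : (x :: w.map Constraint.rhs).Nodup := by
    rw [h.cons_map_rhs]
    exact List.nodup_append.2 ⟨hn, List.nodup_singleton z, by
      intro a ha b hb hab
      rw [List.mem_singleton] at hb
      exact hz (hb ▸ hab ▸ ha)⟩
  exact (List.nodup_cons.1 this).2

/-- A walk either has no repeated vertex, or its shortest final part with a repeated vertex is a simple
cycle followed by a simple path. -/
theorem simple_or_lasso {x z : Literal n} {w : List (Constraint n)} (h : IsWalk K x z w) :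
    ((w.map Constraint.lhs).Nodup ∧ z ∉ w.map Constraint.lhs) ∨
    ∃ y v c p, w = v ++ (c ++ p) ∧ IsWalk K x y v ∧ IsWalk K y y c ∧ IsWalk K y z p ∧
      c ≠ [] ∧ (c.map Constraint.lhs).Nodup ∧ (c.map Constraint.rhs).Nodup ∧
      (p.map Constraint.lhs).Nodup ∧ z ∉ p.map Constraint.lhs := by
  induction h with
  | nil => left; simp
  | cons C hC z w h ih =>
    rcases ih with ⟨hn, hz⟩ | ⟨y, v, c, p, rfl, hv, hrest⟩
    -- The remaining walk is simple, so a repetition can only come from the new first vertex; its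
    -- recurrence, possibly at the endpoint `z`, closes the cycle.
    · by_cases hmem : C.lhs ∈ w.map Constraint.lhs ++ [z]
      · right
        obtain ⟨c, p, rfl, hc, hp, hnot⟩ : ∃ c p, w = c ++ p ∧ IsWalk K C.rhs C.lhs c ∧
            IsWalk K C.lhs z p ∧ C.lhs ∉ c.map Constraint.lhs := by
          by_cases hl : C.lhs ∈ w.map Constraint.lhs
          · obtain ⟨D, hD, hDC⟩ := List.mem_map.1 hl
            obtain ⟨c, p, rfl⟩ := List.append_of_mem hD
            obtain ⟨y, hc, hp⟩ := h.exists_split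
            obtain rfl : y = C.lhs := by rw [← hp.lhs_head, hDC]
            refine ⟨c, D :: p, rfl, hc, hp, fun hcl => ?_⟩
            rw [List.map_append, List.nodup_append] at hn
            exact hn.2.2 _ hcl _ (List.mem_cons_self) hDC.symm
          · obtain rfl : C.lhs = z := by simpa [hl] using hmem
            exact ⟨w, [], (List.append_nil w).symm, h, .nil _, hl⟩
        rw [List.map_append] at hn hz
        have hnc := (List.nodup_append.1 hn).1
        refine ⟨C.lhs, [], C :: c, p, rfl, .nil _, .cons C hC _ c hc, hp, by simp,
          List.nodup_cons.2 ⟨hnot, hnc⟩, ?_, (List.nodup_append.1 hn).2.1,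
          fun hzp => hz (List.mem_append_right _ hzp)⟩
        have := hc.cons_map_rhs
        rw [List.map_cons, this]
        refine List.nodup_append.2 ⟨hnc, List.nodup_singleton _, ?_⟩
        intro a ha b hb hab
        rw [List.mem_singleton] at hb
        exact hnot (hb ▸ hab ▸ ha)
      · left
        rw [List.mem_append, List.mem_singleton, not_or] at hmem
        refine ⟨List.nodup_cons.2 ⟨hmem.1, hn⟩, ?_⟩
        rw [List.map_cons, List.mem_cons, not_or]
        exact ⟨fun e => hmem.2 e.symm, hz⟩
    · right
      exact ⟨y, C :: v, c, p, rfl, .cons C hC y v hv, hrest⟩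

end IsWalk

/-! ### The constraints of iterates of `H` -/

theorem exists_mem_mergeParallel_le {K : Finset (Constraint n)} {C : Constraint n} (hC : C ∈ K) :
    ∃ D ∈ mergeParallel K, D.lhs = C.lhs ∧ D.rhs = C.rhs ∧ ∀ c, D.fn c ≤ C.fn c := by
  classical
  refine ⟨minOfParallel K C hC, ?_, rfl, rfl, fun c => ?_⟩
  · exact Finset.mem_image.2 ⟨⟨C, hC⟩, Finset.mem_attach _ _, rfl⟩
  · refine Finset.inf'_le (fun f : ℝ ≃o ℝ => f c) ?_
    exact Finset.mem_image.2 ⟨C, Finset.mem_filter.2 ⟨hC, rfl, rfl⟩, rfl⟩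

/-- Makes the loop at a literal unique, so a statement about one loop there applies to every loop.
-/
theorem eq_of_mem_mergeParallel {K : Finset (Constraint n)} {C D : Constraint n}
    (hC : C ∈ mergeParallel K) (hD : D ∈ mergeParallel K) (hl : C.lhs = D.lhs)
    (hr : C.rhs = D.rhs) : C = D := by
  classical
  obtain ⟨⟨C, hC⟩, -, rfl⟩ := Finset.mem_image.1 hC
  obtain ⟨⟨D, hD⟩, -, rfl⟩ := Finset.mem_image.1 hD
  obtain ⟨x, y, f⟩ := C
  obtain ⟨x', y', g⟩ := D
  obtain rfl : x = x' := hl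
  obtain rfl : y = y' := hr
  rfl

theorem mem_addCompositions {K : Finset (Constraint n)} {C D : Constraint n} (hC : C ∈ K)
    (hD : D ∈ K) (h : C.rhs = D.lhs) (h₁ : C.rhs ≠ C.lhs) (h₂ : C.rhs ≠ D.rhs) :
    (⟨C.lhs, D.rhs, D.fn.trans C.fn⟩ : Constraint n) ∈ addCompositions K := by
  classical
  refine Finset.mem_union_right _ (Finset.mem_image.2 ⟨(C, D), ?_, rfl⟩)
  exact Finset.mem_filter.2 ⟨Finset.mem_product.2 ⟨hC, hD⟩, h, h₁, h₂⟩

theorem subset_addCompositions (K : Finset (Constraint n)) : K ⊆ addCompositions K := by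
  classical
  exact Finset.subset_union_left

/-- The constraints of `G` bound from below every simple path and simple cycle of `K` of length at
most `m`. -/
def Shortcuts (K G : Finset (Constraint n)) (m : ℕ) : Prop :=
  ∀ x z w, IsWalk K x z w → w ≠ [] → (w.map Constraint.lhs).Nodup →
    (w.map Constraint.rhs).Nodup → w.length ≤ m →
    ∃ C ∈ G, C.lhs = x ∧ C.rhs = z ∧ ∀ c, C.fn c ≤ walkFn w c

theorem shortcuts_one (K : Finset (Constraint n)) : Shortcuts K K 1 := by
  intro x z w h hne _ _ hlen
  cases h with
  | nil => exact absurd rfl hne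
  | cons C hC _ w hw =>
    obtain rfl : w = [] := by simpa using hlen
    exact ⟨C, hC, rfl, hw.eq_of_nil, fun c => le_rfl⟩

/-- Cut the walk after `m` edges and compose the shortcuts of the two pieces. Distinct left ends and
distinct right ends make the middle vertex differ from both endpoints, as `addCompositions` demands,
yet still allow the endpoints to coincide, so that cycles are covered. -/
theorem Shortcuts.mergeParallel_addCompositions {K G : Finset (Constraint n)} {m : ℕ}
    (hm : 1 ≤ m) (h : Shortcuts K G m) :
    Shortcuts K (mergeParallel (addCompositions G)) (m * 2) := by
  suffices hs : Shortcuts K (addCompositions G) (m * 2) by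
    intro x z w hw hne hl hr hlen
    obtain ⟨C, hC, rfl, rfl, hle⟩ := hs x z w hw hne hl hr hlen
    obtain ⟨D, hD, h₁, h₂, hDC⟩ := exists_mem_mergeParallel_le hC
    exact ⟨D, hD, h₁, h₂, fun c => (hDC c).trans (hle c)⟩
  intro x z w hw hne hl hr hlen
  rcases le_or_gt w.length m with hlm | hlm
  · obtain ⟨C, hC, h'⟩ := h x z w hw hne hl hr hlm
    exact ⟨C, subset_addCompositions G hC, h'⟩
  obtain ⟨u, v, rfl, hu, hv, hune, hvne⟩ : ∃ u v, w = u ++ v ∧ u.length ≤ m ∧ v.length ≤ m ∧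
      u ≠ [] ∧ v ≠ [] := by
    refine ⟨w.take m, w.drop m, (List.take_append_drop m w).symm, by simp, ?_, ?_, ?_⟩
    · rw [List.length_drop]; omega
    · rw [← List.length_pos_iff, List.length_take]; omega
    · rw [← List.length_pos_iff, List.length_drop]; omega
  obtain ⟨y, hwu, hwv⟩ := hw.exists_split
  rw [List.map_append] at hl hr
  obtain ⟨hlu, hlv, hld⟩ := List.nodup_append.1 hl
  obtain ⟨hru, hrv, hrd⟩ := List.nodup_append.1 hr
  obtain ⟨C, hC, rfl, rfl, hCu⟩ := h x y u hwu hune hlu hru hu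
  obtain ⟨D, hD, hDC, rfl, hDv⟩ := h _ z v hwv hvne hlv hrv hv
  refine ⟨_, mem_addCompositions hC hD hDC.symm ?_ ?_, rfl, rfl, fun c => ?_⟩
  · exact (hld _ (hwu.mem_map_lhs hune) _ (hwv.mem_map_lhs hvne)).symm
  · exact hrd _ (hwu.mem_map_rhs hune) _ (hwv.mem_map_rhs hvne)
  · rw [walkFn_append]
    exact (hCu _).trans ((walkFn u).monotone (hDv c))

theorem shortcuts_iterate_H (Γ : ContinuousFormula n) (k : ℕ) :
    Shortcuts Γ.constraints (H^[k] Γ).constraints (2 ^ k) := by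
  induction k with
  | zero => exact shortcuts_one _
  | succ k ih =>
    rw [Function.iterate_succ_apply', pow_succ]
    exact ih.mergeParallel_addCompositions Nat.one_le_two_pow

theorem holds_of_mem_iterate_H {Γ : ContinuousFormula n} {a : Fin n → ℝ}
    (ha : ∀ C ∈ Γ.constraints, C.lhs.val a ≤ C.fn (C.rhs.val a)) (k : ℕ) :
    ∀ C ∈ (H^[k] Γ).constraints, C.lhs.val a ≤ C.fn (C.rhs.val a) := by
  classical
  induction k with
  | zero => exact ha
  | succ k ih =>
    rw [Function.iterate_succ_apply']
    intro C hC
    obtain ⟨⟨C, hC'⟩, -, rfl⟩ := Finset.mem_image.1 hC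
    refine Finset.le_inf' (functionsBetween_nonempty _ C hC') _ fun f hf => ?_
    obtain ⟨D, hD, rfl⟩ := Finset.mem_image.1 hf
    obtain ⟨hD, hl, hr⟩ := Finset.mem_filter.1 hD
    change C.lhs.val a ≤ D.fn (C.rhs.val a)
    rw [← hl, ← hr]
    rcases Finset.mem_union.1 hD with hD | hD
    · exact ih D hD
    · obtain ⟨⟨A, B⟩, hAB, rfl⟩ := Finset.mem_image.1 hD
      obtain ⟨hAB, h, -, -⟩ := Finset.mem_filter.1 hAB
      obtain ⟨hA, hB⟩ := Finset.mem_product.1 hAB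
      refine (ih A hA).trans (A.fn.monotone ?_)
      change A.rhs.val a ≤ _
      rw [show A.rhs = B.lhs from h]
      exact ih B hB

/-! ### Tight paths -/

/-- The number of iterations of `H` in the definition of `V`. -/
noncomputable def rounds (n : ℕ) : ℕ := ⌈Real.logb 2 (n : ℝ) + 1⌉₊

theorem logb_natCast_nonneg (n : ℕ) : 0 ≤ Real.logb 2 (n : ℝ) := by
  -- For `n = 0` the logarithm has the default value `0`.
  rcases n.eq_zero_or_pos with rfl | hn
  · simp
  · exact Real.logb_nonneg one_lt_two (by exact_mod_cast hn)

theorem rounds_pos (n : ℕ) : 0 < rounds n :=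
  Nat.ceil_pos.2 (by linarith [logb_natCast_nonneg n])

theorem two_mul_le_two_pow_rounds (n : ℕ) : 2 * n ≤ 2 ^ rounds n := by
  rcases n.eq_zero_or_pos with rfl | hn
  · simp
  have hn' : (0 : ℝ) < n := by exact_mod_cast hn
  have h : Real.logb 2 (n : ℝ) + 1 ≤ (rounds n : ℝ) := Nat.le_ceil _
  have : (2 * n : ℝ) ≤ 2 ^ rounds n := by
    calc (2 * n : ℝ) = (2 : ℝ) ^ (Real.logb 2 (n : ℝ) + 1) := by
          rw [Real.rpow_add two_pos, Real.rpow_logb two_pos (by norm_num) hn', Real.rpow_one,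
            mul_comm]
      _ ≤ (2 : ℝ) ^ (rounds n : ℝ) := Real.rpow_le_rpow_of_exponent_le one_le_two h
      _ = 2 ^ rounds n := Real.rpow_natCast _ _
  exact_mod_cast this

open Classical in
/-- The constraint of `V` that comes from a constraint of the iterate of `H`. -/
noncomputable def toExt (C : Constraint n) : ExtConstraint n :=
  ⟨C.lhs, C.rhs,
    if C.lhs = C.rhs then extend (infComp C.fn) else extend (fun c => (C.fn c : EReal))⟩

theorem toExt_fn_of_eq {C : Constraint n} (h : C.lhs = C.rhs) :
    (toExt C).fn = extend (infComp C.fn) := if_pos h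

theorem toExt_fn_of_ne {C : Constraint n} (h : C.lhs ≠ C.rhs) :
    (toExt C).fn = extendIso C.fn := if_neg h

theorem monotone_toExt_fn (C : Constraint n) : Monotone (toExt C).fn := by
  by_cases h : C.lhs = C.rhs
  · rw [toExt_fn_of_eq h]
    exact monotone_extend (monotone_infComp _)
  · rw [toExt_fn_of_ne h]
    exact monotone_extendIso _

theorem exists_of_mem_V {Γ : ContinuousFormula n} {e : ExtConstraint n} (he : e ∈ Γ.V) :
    ∃ C ∈ (H^[rounds n] Γ).constraints, toExt C = e := he

theorem toExt_mem_V {Γ : ContinuousFormula n} {C : Constraint n}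
    (hC : C ∈ (H^[rounds n] Γ).constraints) : toExt C ∈ Γ.V := ⟨C, hC, rfl⟩

theorem monotone_eval {Γ : ContinuousFormula n} {x y : Literal n} {p : List (ExtConstraint n)}
    (hp : IsPath Γ.V x y p) : Monotone (eval p) := by
  induction hp with
  | single e he =>
    obtain ⟨C, -, rfl⟩ := exists_of_mem_V he
    exact monotone_toExt_fn C
  | cons e he y p hp ih =>
    obtain ⟨C, -, rfl⟩ := exists_of_mem_V he
    exact (monotone_toExt_fn C).comp ih

theorem eval_append (p q : List (ExtConstraint n)) (c : EReal) :
    eval (p ++ q) c = eval p (eval q c) := by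
  simp [eval, List.foldr_append]

theorem isPath_append {V : Set (ExtConstraint n)} {x y z : Literal n}
    {p q : List (ExtConstraint n)} (hp : IsPath V x y p) (hq : IsPath V y z q) :
    IsPath V x z (p ++ q) := by
  induction hp with
  | single e he => exact .cons e he z q hq
  | cons e he y p _ ih => exact .cons e he z _ (ih hq)

theorem ne_nil_of_isPath {V : Set (ExtConstraint n)} {x y : Literal n}
    {p : List (ExtConstraint n)} (hp : IsPath V x y p) : p ≠ [] := by
  induction hp <;> simp

theorem isPath_single_toExt {Γ : ContinuousFormula n} {C : Constraint n}
    (hC : C ∈ (H^[rounds n] Γ).constraints) : IsPath Γ.V C.lhs C.rhs [toExt C] :=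
  .single (toExt C) (toExt_mem_V hC)

theorem eq_of_mem_iterate_H {Γ : ContinuousFormula n} {C D : Constraint n}
    (hC : C ∈ (H^[rounds n] Γ).constraints) (hD : D ∈ (H^[rounds n] Γ).constraints)
    (hl : C.lhs = D.lhs) (hr : C.rhs = D.rhs) : C = D := by
  obtain ⟨k, hk⟩ := Nat.exists_eq_succ_of_ne_zero (rounds_pos n).ne'
  rw [hk, Function.iterate_succ_apply'] at hC hD
  exact eq_of_mem_mergeParallel hC hD hl hr

/-- A walk with distinct left ends has at most as many edges as there are literals, namely `2n ≤ 2 ^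
rounds n`. -/
theorem exists_shortcut {Γ : ContinuousFormula n} {x z : Literal n} {w : List (Constraint n)}
    (hw : IsWalk Γ.constraints x z w) (hne : w ≠ []) (hl : (w.map Constraint.lhs).Nodup)
    (hr : (w.map Constraint.rhs).Nodup) :
    ∃ C ∈ (H^[rounds n] Γ).constraints, C.lhs = x ∧ C.rhs = z ∧ ∀ c, C.fn c ≤ walkFn w c := by
  refine shortcuts_iterate_H Γ (rounds n) x z w hw hne hl hr ?_
  have := hl.length_le_card
  rw [List.length_map, Literal.card_eq] at this
  exact this.trans (two_mul_le_two_pow_rounds n)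

/-- Every walk is bounded below by a tight path or by the empty walk. If the tight path ends with a
loop, then that loop strictly decreases the starting value. -/
theorem exists_tight_le (Γ : ContinuousFormula n) (N : ℕ) :
    ∀ (w : List (Constraint n)), w.length ≤ N → ∀ (x z : Literal n) (d : EReal),
    IsWalk Γ.constraints x z w →
    (x = z ∧ d ≤ extendIso (walkFn w) d) ∨
    ∃ p, IsPath Γ.V x z p ∧ IsTight p ∧ eval p d ≤ extendIso (walkFn w) d ∧
      ∀ e ∈ p.getLast?, e.lhs = e.rhs →
        ∀ C ∈ (H^[rounds n] Γ).constraints, C.lhs = z → C.rhs = z → extendIso C.fn d < d := by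
  induction N with
  | zero =>
    intro w hlen x z d hw
    obtain rfl : w = [] := by simpa using hlen
    exact Or.inl ⟨hw.eq_of_nil, (extendIso_refl d).ge⟩
  | succ N ih =>
    intro w hlen x z d hw
    rcases hw.simple_or_lasso with ⟨hn, hz⟩ | ⟨y, v, c, p, rfl, hv, hc, hp, hcne, hcl, hcr, hpl, hpz⟩
    · rcases eq_or_ne w [] with rfl | hne
      · exact Or.inl ⟨hw.eq_of_nil, (extendIso_refl d).ge⟩
      right
      obtain ⟨C, hC, rfl, rfl, hle⟩ := exists_shortcut hw hne hn (hw.nodup_map_rhs hn hz)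
      have hxz : C.lhs ≠ C.rhs := fun h => hz (h ▸ hw.mem_map_lhs hne)
      refine ⟨[toExt C], isPath_single_toExt hC, List.isChain_singleton _, ?_, ?_⟩
      · change (toExt C).fn d ≤ _
        rw [toExt_fn_of_ne hxz]
        exact extendIso_le hle d
      · intro e he hloop
        obtain rfl : toExt C = e := by simpa using he
        exact absurd hloop hxz
    -- Functions act from the right: `dy` is the value on entering the cycle. Since `c` is nonempty,
    -- both `v ++ p` and `v` are shorter walks.
    have hclen := List.length_pos_iff.2 hcne
    simp only [List.length_append] at hlen
    set dy : EReal := extendIso (walkFn p) d with hdy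
    have hval : extendIso (walkFn (v ++ (c ++ p))) d =
        extendIso (walkFn v) (extendIso (walkFn c) dy) := by
      rw [walkFn_append, walkFn_append, extendIso_trans, extendIso_trans]
    rcases le_or_gt dy (extendIso (walkFn c) dy) with hcut | hdec
    · have hle : extendIso (walkFn (v ++ p)) d ≤ extendIso (walkFn (v ++ (c ++ p))) d := by
        rw [hval, walkFn_append, extendIso_trans]
        exact monotone_extendIso _ hcut
      rcases ih (v ++ p) (by rw [List.length_append]; omega) x z d (hv.append hp) with
        ⟨h₁, h₂⟩ | ⟨q, h₁, h₂, h₃, h₄⟩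
      · exact Or.inl ⟨h₁, h₂.trans hle⟩
      · exact Or.inr ⟨q, h₁, h₂, h₃.trans hle, h₄⟩
    right
    obtain ⟨L, hL, rfl, hLr, hLle⟩ := exists_shortcut hc hcne hcl hcr
    have hLloop : L.lhs = L.rhs := hLr.symm
    have hLdec : extendIso L.fn dy < dy := (extendIso_le hLle dy).trans_lt hdec
    -- the final part of the path: the loop, and the edge that replaces `p`
    obtain ⟨q, hq, hqt, hqle, hqhead, hqlast, hqfix⟩ : ∃ q, IsPath Γ.V L.lhs z q ∧ IsTight q ∧
        eval q d ≤ extendIso (walkFn c) dy ∧ (∀ e ∈ q.head?, e.lhs = e.rhs) ∧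
        (∀ e ∈ q.getLast?, e.lhs = e.rhs →
          ∀ C ∈ (H^[rounds n] Γ).constraints, C.lhs = z → C.rhs = z → extendIso C.fn d < d) ∧
        eval q d ≤ extendIso L.fn (eval q d) := by
      have hbound : extend (infComp L.fn) dy ≤ extendIso (walkFn c) dy :=
        (extend_infComp_le hLdec).trans (extendIso_le hLle dy)
      rcases eq_or_ne p [] with rfl | hpne
      · obtain rfl := hp.eq_of_nil
        have hd : dy = d := extendIso_refl d
        have hev : eval [toExt L] d = extend (infComp L.fn) d :=
          congrFun (toExt_fn_of_eq hLloop) d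
        refine ⟨[toExt L], ?_, List.isChain_singleton _, ?_, ?_, ?_, ?_⟩
        · have := isPath_single_toExt hL
          rwa [hLr] at this
        · rw [hev, ← hd]; exact hbound
        · intro e he
          obtain rfl : toExt L = e := by simpa using he
          exact hLloop
        · intro e _ _ C hC h₁ h₂
          obtain rfl := eq_of_mem_iterate_H hC hL h₁ (h₂.trans hLloop)
          rw [← hd]; exact hLdec
        · rw [hev]; exact extend_infComp_le_extendIso _ _
      · obtain ⟨D, hD, hDl, rfl, hDle⟩ := exists_shortcut hp hpne hpl (hp.nodup_map_rhs hpl hpz)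
        have hDne : D.lhs ≠ D.rhs := fun h => hpz (h ▸ hDl ▸ hp.mem_map_lhs hpne)
        have hev : eval [toExt L, toExt D] d = extend (infComp L.fn) (extendIso D.fn d) := by
          change (toExt L).fn ((toExt D).fn d) = _
          rw [toExt_fn_of_eq hLloop, toExt_fn_of_ne hDne]
        refine ⟨[toExt L, toExt D], ?_, ?_, ?_, ?_, ?_, ?_⟩
        · refine .cons (toExt L) (toExt_mem_V hL) _ _ ?_
          have := isPath_single_toExt hD
          rwa [hDl, ← hLr] at this
        · exact List.isChain_pair.2 ⟨fun _ => hDne, fun _ => hLloop⟩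
        · rw [hev]
          exact (monotone_extend (monotone_infComp _) (extendIso_le hDle d)).trans hbound
        · intro e he
          obtain rfl : toExt L = e := by simpa using he
          exact hLloop
        · intro e he hloop
          obtain rfl : toExt D = e := by simpa using he
          exact absurd hloop hDne
        · rw [hev]; exact extend_infComp_le_extendIso _ _
    have hle : extendIso (walkFn v) (eval q d) ≤ extendIso (walkFn (v ++ (c ++ p))) d := by
      rw [hval]; exact monotone_extendIso _ hqle
    -- The induction is restarted at the value `eval q d`, which the loop `L` no longer lowers.
    rcases ih v (by omega) x L.lhs (eval q d) hv with ⟨rfl, h₂⟩ | ⟨r, h₁, h₂, h₃, h₄⟩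
    · exact ⟨q, hq, hqt, h₂.trans hle, hqlast⟩
    · refine ⟨r ++ q, isPath_append h₁ hq, ?_, ?_, ?_⟩
      · refine List.isChain_append.2 ⟨h₂, hqt, fun e he e' he' => ?_⟩
        -- If `r` ended with a loop, every loop at this literal, in particular `L`, would lower
        -- `eval q d`. So `r` ends with a non-loop, while `q` starts with a loop.
        have hne : ¬ e.lhs = e.rhs := fun hloop =>
          absurd (h₄ e he hloop L hL rfl hLr) hqfix.not_gt
        exact ⟨fun h => absurd h hne, fun h => absurd (hqhead e' he') h⟩
      · rw [eval_append]; exact h₃.trans hle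
      · have hqne : q ≠ [] := ne_nil_of_isPath hq
        rw [List.getLast?_append_of_ne_nil _ hqne]
        exact hqlast

/-- The first alternative accounts for the empty walk, since paths of `V` are nonempty. -/
theorem minTight_le_walkFn {Γ : ContinuousFormula n} {x z : Literal n} {w : List (Constraint n)}
    (hw : IsWalk Γ.constraints x z w) (d : ℝ) :
    (x = z ∧ d ≤ walkFn w d) ∨ Γ.minTight x z d ≤ (walkFn w d : EReal) := by
  rcases exists_tight_le Γ w.length w le_rfl x z d hw with ⟨h₁, h₂⟩ | ⟨p, h₁, h₂, h₃, -⟩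
  · exact Or.inl ⟨h₁, EReal.coe_le_coe_iff.1 h₂⟩
  · exact Or.inr (le_trans (sInf_le (Exists.intro p ⟨h₁, h₂, rfl⟩)) h₃)

theorem val_le_minTight {Γ : ContinuousFormula n} {a : Fin n → ℝ}
    (ha : ∀ C ∈ Γ.constraints, C.lhs.val a ≤ C.fn (C.rhs.val a)) (x y : Literal n) {d : ℝ}
    (hd : y.val a ≤ d) : (x.val a : EReal) ≤ Γ.minTight x y d := by
  have hedge : ∀ e ∈ Γ.V, (e.lhs.val a : EReal) ≤ e.fn (e.rhs.val a) := by
    intro e he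
    obtain ⟨C, hC, rfl⟩ := exists_of_mem_V he
    have hval := holds_of_mem_iterate_H ha (rounds n) C hC
    change (C.lhs.val a : EReal) ≤ (toExt C).fn (C.rhs.val a)
    by_cases h : C.lhs = C.rhs
    · rw [toExt_fn_of_eq h, ← h, extend_coe]
      exact le_infComp (by rwa [← h] at hval)
    · rw [toExt_fn_of_ne h]
      exact EReal.coe_le_coe_iff.2 hval
  refine le_sInf ?_
  rintro _ ⟨p, hp, -, rfl⟩
  refine le_trans ?_ (monotone_eval hp (EReal.coe_le_coe_iff.2 hd))
  clear hd
  induction hp with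
  | single e he => exact hedge e he
  | cons e he y p _ ih =>
    obtain ⟨C, -, rfl⟩ := exists_of_mem_V he
    exact (hedge _ he).trans (monotone_toExt_fn C ih)

/-! ### Fixing the variables one after the other -/

theorem dual_apply (f : ℝ ≃o ℝ) (c : ℝ) : dual f c = -f.symm (-c) := rfl

/-- A family of relations `x ≤ f y` between literals that is closed under composition and duality. -/
structure IsClosedSystem (R : Literal n → Literal n → (ℝ ≃o ℝ) → Prop) : Prop where
  refl : ∀ x, R x x (OrderIso.refl ℝ)
  trans : ∀ {x y z f g}, R x y f → R y z g → R x z (g.trans f)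
  dual : ∀ {x y f}, R x y f → R (-y) (-x) (dual f)

/-- The upper bounds `m x` of the literals are consistent with the relations. The lower bound of `x`
is `-m (-x)`. -/
def Consistent (R : Literal n → Literal n → (ℝ ≃o ℝ) → Prop) (m : Literal n → ℝ) : Prop :=
  ∀ x y f, R x y f → -m (-x) ≤ f (m y)

/-- The greatest value of the literal `x` that the upper bounds `m` allow. -/
noncomputable def upper (R : Literal n → Literal n → (ℝ ≃o ℝ) → Prop) (m : Literal n → ℝ)
    (x : Literal n) : ℝ :=
  sInf {t | ∃ y f, R x y f ∧ t = f (m y)}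

section ClosedSystem

variable {R : Literal n → Literal n → (ℝ ≃o ℝ) → Prop} {m : Literal n → ℝ}

/-- Consistency bounds the set below by `-m (-x)`, so the real `sInf` is a genuine infimum. -/
theorem upper_le (hm : Consistent R m) {x y : Literal n} {f : ℝ ≃o ℝ} (h : R x y f) :
    upper R m x ≤ f (m y) := by
  refine csInf_le ⟨-m (-x), ?_⟩ ⟨y, f, h, rfl⟩
  rintro _ ⟨z, g, hg, rfl⟩
  exact hm x z g hg

theorem le_upper (hR : IsClosedSystem R) {x : Literal n} {t : ℝ}
    (h : ∀ y f, R x y f → t ≤ f (m y)) : t ≤ upper R m x := by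
  refine le_csInf ⟨_, x, _, hR.refl x, rfl⟩ ?_
  rintro _ ⟨y, f, hf, rfl⟩
  exact h y f hf

theorem upper_le_apply_upper (hR : IsClosedSystem R) (hm : Consistent R m) {x y : Literal n}
    {f : ℝ ≃o ℝ} (h : R x y f) : upper R m x ≤ f (upper R m y) := by
  rw [← f.symm_apply_le]
  refine le_upper hR fun z g hg => ?_
  rw [f.symm_apply_le]
  exact upper_le hm (hR.trans h hg)

/-- The tightened interval is nonempty: by duality a bound `x ≤ f y` becomes a bound on `-y` in
terms of `-x`, and consistency gives `-m y ≤ upper R m (-y)`. -/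
theorem neg_upper_neg_le_upper (hR : IsClosedSystem R) (hm : Consistent R m) (x : Literal n) :
    -upper R m (-x) ≤ upper R m x := by
  refine le_upper hR fun y f hf => ?_
  have h₁ := upper_le_apply_upper hR hm (hR.dual hf)
  have h₂ : -m y ≤ upper R m (-y) := by
    refine le_upper hR fun z g hg => ?_
    have := hm _ z g hg
    rwa [Literal.neg_involutive] at this
  rw [dual_apply] at h₁
  rw [← f.symm_apply_le]
  linarith

/-- One variable can be fixed to a single value. -/
theorem exists_fix (hR : IsClosedSystem R) (hm : Consistent R m) (x : Literal n)
    (h₂ : ∀ c, -m (-x) ≤ c → c ≤ m x → ∀ f g, R x (-x) f → R (-x) x g →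
      ¬ (f (-c) < c ∧ g c < -c)) :
    ∃ c, c ≤ m x ∧ -c ≤ m (-x) ∧
      Consistent R (Function.update (Function.update m x c) (-x) (-c)) := by
  set u := upper R m x with hu
  set l := -upper R m (-x) with hl
  have hlu : l ≤ u := neg_upper_neg_le_upper hR hm x
  have hum : u ≤ m x := upper_le hm (hR.refl x)
  have hlm : -m (-x) ≤ l := neg_le_neg (upper_le hm (hR.refl (-x)))
  -- Choose the greatest `c` in `[l, u]` allowed by all relations from `x` to `-x`. The left end `l`
  -- is allowed, as `l ≤ u ≤ f (-l)`.
  obtain ⟨c, ⟨hcA, hlc, hcu⟩, hmax⟩ : ∃ c, IsGreatest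
      ({c | ∀ f, R x (-x) f → c ≤ f (-c)} ∩ Set.Icc l u) c := by
    refine IsCompact.exists_isGreatest (isCompact_Icc.inter_left ?_) ⟨l, ?_, le_rfl, hlu⟩
    · simp only [Set.ofPred_forall]
      exact isClosed_iInter fun f => isClosed_iInter fun _ =>
        isClosed_le continuous_id (f.continuous.comp continuous_neg)
    · intro f hf
      rw [hl, neg_neg]
      exact hlu.trans (upper_le_apply_upper hR hm hf)
  have hnotA : ∀ c', c < c' → c' ≤ u → ∃ f, R x (-x) f ∧ f (-c') < c' := by
    intro c' hcc' hc'u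
    by_contra! hA
    exact absurd (hmax ⟨hA, hlc.trans hcc'.le, hc'u⟩) hcc'.not_ge
  have hS : ∀ v, R x x v → c ≤ v c := by
    intro v hv
    rcases hcu.eq_or_lt with rfl | hcu
    · exact upper_le_apply_upper hR hm hv
    by_contra! hvc
    have hc₁ : c < v.symm c := v.lt_symm_apply.2 hvc
    -- A loop with `v c < c` would let some `f` exclude `min (v.symm c) u`. But `v ∘ f ∘ dual v`
    -- also relates `x` to `-x`, and the bound it puts on `c` says `v.symm c ≤ f (-v.symm c)`, a
    -- contradiction.
    obtain ⟨f, hf, hlt⟩ := hnotA (min (v.symm c) u) (lt_min hc₁ hcu) (min_le_right _ _)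
    have h := hcA _ (hR.trans (hR.trans hv hf) (hR.dual hv))
    change c ≤ v (f (-v.symm (- -c))) at h
    rw [neg_neg, ← v.symm_apply_le] at h
    refine hlt.not_ge ((min_le_left _ _).trans (h.trans (f.monotone ?_)))
    exact neg_le_neg (min_le_left _ _)
  have hB : ∀ g, R (-x) x g → -c ≤ g c := by
    intro g hg
    rcases hcu.eq_or_lt with rfl | hcu
    · have := upper_le_apply_upper hR hm hg
      linarith
    by_contra! hgc
    -- If `g c < -c`, then also `g c' < -c'` for some `c'` slightly above `c`. By maximality of `c`
    -- some `f` excludes `c'` too, so `c'` violates `h₂`.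
    obtain ⟨t, hgt, htc⟩ := exists_between hgc
    obtain ⟨c', hcc', hc'⟩ := exists_between
      (lt_min hcu (lt_min (g.lt_symm_apply.2 hgt) (lt_neg.2 htc)))
    rw [lt_min_iff, lt_min_iff] at hc'
    obtain ⟨f, hf, hlt⟩ := hnotA c' hcc' hc'.1.le
    refine h₂ c' (by linarith) (by linarith) f g hf hg ⟨hlt, ?_⟩
    have := g.lt_symm_apply.1 hc'.2.1
    linarith
  have hxx : x ≠ -x := (Literal.neg_ne_self x).symm
  refine ⟨c, hcu.trans hum, by linarith, ?_⟩
  set m' := Function.update (Function.update m x c) (-x) (-c) with hm'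
  have hm'x : m' x = c := by simp [hm', hxx]
  have hm'nx : m' (-x) = -c := by simp [hm']
  have hm'o : ∀ y, y ≠ x → y ≠ -x → m' y = m y := by
    intro y h h'
    simp [hm', h, h']
  have hfromx : ∀ y f, R x y f → c ≤ f (m y) := fun y f hf => hcu.trans (upper_le hm hf)
  have hfromnx : ∀ y f, R (-x) y f → -c ≤ f (m y) := fun y f hf =>
    le_trans (by linarith) (upper_le hm hf)
  intro y z f hf
  by_cases hy : y = x
  · subst hy
    rw [hm'nx, neg_neg]
    by_cases hz : z = y
    · subst hz; rw [hm'x]; exact hS f hf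
    by_cases hz' : z = -y
    · subst hz'; rw [hm'nx]; exact hcA f hf
    rw [hm'o z hz hz']; exact hfromx z f hf
  by_cases hy' : y = -x
  · subst hy'
    rw [Literal.neg_involutive, hm'x]
    by_cases hz : z = x
    · subst hz; rw [hm'x]; exact hB f hf
    by_cases hz' : z = -x
    · subst hz'; rw [hm'nx]
      -- A loop at `-x` is dual to a loop at `x`, already handled by `hS`.
      have h := hR.dual hf
      rw [Literal.neg_involutive] at h
      have := hS _ h
      rw [dual_apply] at this
      rw [← f.symm_apply_le]
      linarith
    rw [hm'o z hz hz']; exact hfromnx z f hf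
  have hny : -y ≠ x := fun h => hy' (by rw [← h, Literal.neg_involutive])
  have hny' : -y ≠ -x := fun h => hy (by rw [← Literal.neg_involutive y, h, Literal.neg_involutive])
  rw [hm'o (-y) hny hny', ← f.symm_apply_le]
  by_cases hz : z = x
  · subst hz
    have := hfromnx _ _ (hR.dual hf)
    rw [dual_apply] at this
    rw [hm'x]; linarith
  by_cases hz' : z = -x
  · subst hz'
    have h := hR.dual hf
    rw [Literal.neg_involutive] at h
    have := hfromx _ _ h
    rw [dual_apply] at this
    rw [hm'nx]; linarith
  rw [hm'o z hz hz', f.symm_apply_le]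
  exact hm y z f hf

/-- All variables can be fixed to single values. -/
theorem exists_consistent_fixed (hR : IsClosedSystem R) (hm : Consistent R m)
    (h₂ : ∀ x c, -m (-x) ≤ c → c ≤ m x → ∀ f g, R x (-x) f → R (-x) x g →
      ¬ (f (-c) < c ∧ g c < -c)) (s : Finset (Fin n)) :
    ∃ m' : Literal n → ℝ, (∀ x, m' x ≤ m x) ∧ Consistent R m' ∧
      ∀ i ∈ s, m' (.neg i) = -m' (.pos i) := by
  induction s using Finset.induction_on with
  | empty => exact ⟨m, fun _ => le_rfl, hm, by simp⟩
  | insert i s _ ih =>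
    obtain ⟨m', hle, hm', hfix⟩ := ih
    -- The bounds only shrink, so `h₂` for `m` applies to `m'`.
    obtain ⟨c, hc, hc', hcons⟩ := exists_fix hR hm' (.pos i) fun c h₃ h₄ =>
      h₂ _ c ((neg_le_neg (hle _)).trans h₃) (h₄.trans (hle _))
    rw [Literal.neg_pos] at hc' hcons
    refine ⟨_, fun x => ?_, hcons, fun j hj => ?_⟩
    · refine le_trans ?_ (hle x)
      rcases eq_or_ne x (.neg i) with rfl | hx
      · simpa using hc'
      rcases eq_or_ne x (.pos i) with rfl | hx'
      · simpa using hc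
      simp [hx, hx']
    · rcases eq_or_ne j i with rfl | hji
      · simp
      · have := hfix j ((Finset.mem_insert.1 hj).resolve_left hji)
        simpa [hji] using this

end ClosedSystem

/-! ### The relations given by walks -/

/-- `x ≤ f y` follows from a walk in `K`. -/
def Reaches (K : Finset (Constraint n)) (x y : Literal n) (f : ℝ ≃o ℝ) : Prop :=
  ∃ w, IsWalk K x y w ∧ walkFn w = f

theorem reaches_of_mem {K : Finset (Constraint n)} {C : Constraint n} (hC : C ∈ K) :
    Reaches K C.lhs C.rhs C.fn :=
  ⟨[C], .cons C hC _ [] (.nil _), rfl⟩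

theorem Reaches.trans {K : Finset (Constraint n)} {x y z : Literal n} {f g : ℝ ≃o ℝ}
    (hf : Reaches K x y f) (hg : Reaches K y z g) : Reaches K x z (g.trans f) := by
  obtain ⟨v, hv, rfl⟩ := hf
  obtain ⟨w, hw, rfl⟩ := hg
  exact ⟨v ++ w, hv.append hw, walkFn_append v w⟩

theorem dual_refl : dual (OrderIso.refl ℝ) = OrderIso.refl ℝ := by
  ext c
  exact neg_neg c

theorem dual_trans (f g : ℝ ≃o ℝ) : dual (g.trans f) = (dual f).trans (dual g) := by
  ext c
  change -g.symm (f.symm (-c)) = -g.symm (- -f.symm (-c))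
  rw [neg_neg]

theorem isClosedSystem_reaches {Γ : ContinuousFormula n} (hsymm : Γ.IsSymmetric) :
    IsClosedSystem (Reaches Γ.constraints) where
  refl x := ⟨[], .nil x, rfl⟩
  trans := Reaches.trans
  dual := by
    rintro x y f ⟨w, hw, rfl⟩
    induction hw with
    | nil x => exact ⟨[], .nil _, dual_refl.symm⟩
    | cons C hC y w _ ih =>
      rw [walkFn_cons, dual_trans]
      exact ih.trans (reaches_of_mem (hsymm C hC))

/-! ### Ranges of literals and sufficiency of the criterion -/

theorem neg_rangeMax_neg (Γ : ContinuousFormula n) (x : Literal n) :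
    -Γ.rangeMax (-x) = Γ.rangeMin x := by
  cases x
  · exact neg_neg _
  · rfl

theorem val_mem_range {Γ : ContinuousFormula n} {a : Fin n → ℝ}
    (ha : ∀ i, a i ∈ Set.Icc (Γ.lo i) (Γ.hi i)) (x : Literal n) : x.val a ∈ Γ.range x := by
  cases x with
  | pos i => exact ha i
  | neg i => exact ⟨neg_le_neg (ha i).2, neg_le_neg (ha i).1⟩

theorem rangeMin_le_rangeMax (Γ : ContinuousFormula n) (x : Literal n) :
    Γ.rangeMin x ≤ Γ.rangeMax x := by
  have h := val_mem_range (Γ := Γ) (a := Γ.lo) (fun i => ⟨le_rfl, Γ.lo_le_hi i⟩) x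
  exact h.1.trans h.2

/-- Tight minima lie below walk values, so the two hypotheses pass to all walks; empty walks are
harmless because ranges are nonempty and `-x ≠ x`. Once all variables are fixed, consistency of the
one-edge walks is satisfaction of `Γ`. -/
theorem satisfiable_of_minTight {Γ : ContinuousFormula n} (hsymm : Γ.IsSymmetric)
    (h₁ : ∀ x y, (Γ.rangeMin x : EReal) ≤ Γ.minTight x y (Γ.rangeMax y))
    (h₂ : ∀ x, ∀ c ∈ Γ.range x, ¬ (Γ.minTight x (-x) (-c : ℝ) < (c : EReal) ∧
      Γ.minTight (-x) x c < ((-c : ℝ) : EReal))) :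
    Γ.Satisfiable := by
  have hm : Consistent (Reaches Γ.constraints) Γ.rangeMax := by
    rintro x y _ ⟨w, hw, rfl⟩
    rw [neg_rangeMax_neg]
    rcases minTight_le_walkFn hw (Γ.rangeMax y) with ⟨rfl, h⟩ | h
    · exact (rangeMin_le_rangeMax Γ x).trans h
    · exact EReal.coe_le_coe_iff.1 ((h₁ x y).trans h)
  obtain ⟨m, hle, hcons, hfix⟩ := exists_consistent_fixed (isClosedSystem_reaches hsymm) hm (by
    rintro x c hc hc' _ _ ⟨v, hv, rfl⟩ ⟨w, hw, rfl⟩ ⟨hlt, hlt'⟩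
    rw [neg_rangeMax_neg] at hc
    refine h₂ x c ⟨hc, hc'⟩ ⟨?_, ?_⟩
    · rcases minTight_le_walkFn hv (-c) with ⟨h, -⟩ | h
      · exact absurd h.symm (Literal.neg_ne_self x)
      · exact h.trans_lt (EReal.coe_lt_coe_iff.2 hlt)
    · rcases minTight_le_walkFn hw c with ⟨h, -⟩ | h
      · exact absurd h (Literal.neg_ne_self x)
      · exact h.trans_lt (EReal.coe_lt_coe_iff.2 hlt')) Finset.univ
  have hval : ∀ x : Literal n, x.val (fun i => m (.pos i)) = m x := by
    intro x
    cases x with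
    | pos i => rfl
    | neg i => exact (hfix i (Finset.mem_univ i)).symm
  refine ⟨fun i => m (.pos i), fun i => ⟨?_, hle (.pos i)⟩, fun C hC => ?_⟩
  · have h := hle (.neg i)
    rw [hfix i (Finset.mem_univ i)] at h
    exact neg_le_neg_iff.1 h
  · have h := hcons _ _ _ (reaches_of_mem hC)
    rw [← hval, ← hval, Literal.val_neg, neg_neg] at h
    exact h

end ContinuousTwoSAT

/-! ### The satisfiability criterion -/

theorem mainTheorem4 {n : ℕ} (Γ : ContinuousTwoSAT.ContinuousFormula n)
    (hsymm : Γ.IsSymmetric) :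
    Γ.Satisfiable ↔
      ¬ (∃ x y : ContinuousTwoSAT.Literal n,
          Γ.minTight x y (Γ.rangeMax y) < ((Γ.rangeMin x : ℝ) : EReal)) ∧
      ¬ (∃ x : ContinuousTwoSAT.Literal n, ∃ c ∈ Γ.range x,
          Γ.minTight x (-x) (-c) < ((c : ℝ) : EReal) ∧
          Γ.minTight (-x) x c < ((-c : ℝ) : EReal)) := by
  constructor
  · rintro ⟨a, har, hac⟩
    refine ⟨?_, ?_⟩
    · rintro ⟨x, y, hlt⟩
      have h := ContinuousTwoSAT.val_le_minTight hac x y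
        (ContinuousTwoSAT.val_mem_range har y).2
      have := EReal.coe_lt_coe_iff.1 (h.trans_lt hlt)
      exact this.not_ge (ContinuousTwoSAT.val_mem_range har x).1
    · rintro ⟨x, c, -, hlt, hlt'⟩
      -- Any `c` at most the value of `x` is kept by the paths `x → -x`, any `c` at least that value
      -- by the paths `-x → x`.
      rcases le_total c (x.val a) with hc | hc
      · have h := ContinuousTwoSAT.val_le_minTight hac x (-x) (d := -c)
          (by rw [ContinuousTwoSAT.Literal.val_neg]; exact neg_le_neg hc)
        exact (EReal.coe_lt_coe_iff.1 (h.trans_lt hlt)).not_ge hc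
      · have h := ContinuousTwoSAT.val_le_minTight hac (-x) x hc
        have := EReal.coe_lt_coe_iff.1 (h.trans_lt hlt')
        rw [ContinuousTwoSAT.Literal.val_neg] at this
        linarith
  · rintro ⟨h₁, h₂⟩
    refine ContinuousTwoSAT.satisfiable_of_minTight hsymm ?_ ?_
    · intro x y
      by_contra! h
      exact h₁ ⟨x, y, h⟩
    · rintro x c hc ⟨h, h'⟩
      exact h₂ ⟨x, c, hc, h, h'⟩
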